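/- Let $n,m\ge 0$ be integers, let $D=\mathbb{R}[d_1,\dots,d_n]$ and $R=\mathbb{R}[x_1,\dots,x_n]$, and let $D^i$, $R^j$ denote their homogeneous pieces of degrees $i$, $j$. Put $$H=H_{n,m}=\bigoplus_{i=0}^{m}H^{-m+2i},\qquad H^{-m+2i}:=D^i\otimes_{\mathbb{R}} R^{m-i}\quad(0\le i\le m),$$ and $H^k=0$ for all other integers $k$. This is a finite-dimensional graded real vector space; the symmetric group $S_n$ acts on $D$ and on $R$ by permuting the indices of the variables, and hence diagonally on $H$, preserving each $H^k$. For $d\in D$ and $f\in R$ let $(d,f):=(d\cdot f)(0)$, where $d$ acts on $f$ as the constant-coefficient differential operator obtained by substituting $\partial/\partial x_i$ for $d_i$, and the result is evaluated at $x=0$. Define a bilinear pairing on $H$ by $$\langle d\otimes f,\;d'\otimes f'\rangle:=(d,f')\,(d',f),$$ extended bilinearly, and define the linear map $$L:=\sum_{i=1}^{n} d_i\otimes\frac{\partial}{\partial x_i}$$ on $H$, where $d_i$ acts by multiplication. Then: (a) (Poincaré duality) The pairing $\langle-,-\rangle:H\times H\to\mathbb{R}$ is $S_n$-equivariant (that is,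 $\langle\sigma a,\sigma b\rangle=\langle a,b\rangle$ for all $\sigma\in S_n$ and $a,b\in H$), symmetric, graded (that is, $\langle H^i,H^j\rangle=0$ whenever $i\ne -j$) and non-degenerate. (b) (Hard Lefschetz) $L$ is $S_n$-equivariant, maps $H^i$ into $H^{i+2}$ for all $i$, and satisfies $\langle La,b\rangle=\langle a,Lb\rangle$ for all $a,b\in H$; and for every integer $i\ge 0$ the map $L^i:H^{-i}\to H^{i}$ is an isomorphism. (c) (Hodge–Riemann relations) For every integer $i$ with $0\le i\le m/2$, the bilinear form $(a,b)_L^{-m+2i}:=\langle a,L^{m-2i}b\rangle$ on $H^{-m+2i}$ is $S_n$-equivariant, and it is $(-1)^i$-definite on the primitive subspace $P_L^{-m+2i}:=\ker(L^{m-2i+1})\cap H^{-m+2i}$; that is, $(-1)^i\,(a,a)_L^{-m+2i}>0$ for every non-zero $a\in P_L^{-m+2i}$. -/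

import Mathlib

open scoped TensorProduct

/-! ### Linear algebra of graded vector spaces with a bilinear form

Throughout, `V` is a real vector space (a module over `ℝ`, so that negation is automatic), `𝒱 k` (for `k : ℤ`) are its graded pieces, `B` is a
bilinear form on `V` and `L` a linear endomorphism of `V`. -/

namespace KahlerPackage

variable {V : Type*} [AddCommMonoid V] [Module ℝ V]

/-- The form `B` is graded: `B (𝒱 i) (𝒱 j) = 0` unless `i = -j`. -/
def IsGradedForm (𝒱 : ℤ → Submodule ℝ V) (B : V →ₗ[ℝ] V →ₗ[ℝ] ℝ) : Prop :=
  ∀ i j : ℤ, i ≠ -j → ∀ a ∈ 𝒱 i, ∀ b ∈ 𝒱 j, B a b = 0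

/-- `L` is a Lefschetz operator: it has degree two and is self-adjoint for `B`. -/
structure IsLefschetzOperator (𝒱 : ℤ → Submodule ℝ V) (B : V →ₗ[ℝ] V →ₗ[ℝ] ℝ)
    (L : Module.End ℝ V) : Prop where
  degree_two : ∀ i : ℤ, ∀ a ∈ 𝒱 i, L a ∈ 𝒱 (i + 2)
  self_adjoint : ∀ a b : V, B (L a) b = B a (L b)

/-- Hard Lefschetz: for all `i ≥ 0`, the linear map `L ^ i` restricts to a bijection
`𝒱 (-i) → 𝒱 i`. -/
def HardLefschetz (𝒱 : ℤ → Submodule ℝ V) (L : Module.End ℝ V) : Prop :=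
  ∀ i : ℕ, Set.BijOn (L ^ i) (𝒱 (-(i : ℤ))) (𝒱 (i : ℤ))

/-- The bilinear form `(a, b) ↦ B a (L ^ r b)`; on `𝒱 (-r)` it is the Lefschetz form. -/
def lefschetzForm (B : V →ₗ[ℝ] V →ₗ[ℝ] ℝ) (L : Module.End ℝ V) (r : ℕ) :
    V →ₗ[ℝ] V →ₗ[ℝ] ℝ :=
  B.compl₂ (L ^ r)

/-- The primitive subspace `ker (L ^ (r + 1)) ∩ 𝒱 (-r)` of degree `-r`. -/
def primitive (𝒱 : ℤ → Submodule ℝ V) (L : Module.End ℝ V) (r : ℕ) : Submodule ℝ V :=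
  LinearMap.ker (L ^ (r + 1)) ⊓ 𝒱 (-(r : ℤ))

end KahlerPackage

/-! ### The graded space `H_{n,m}` with its pairing, operator and `S_n`-action -/

namespace HomCohom

noncomputable section

/-- `D = ℝ[d_1, …, d_n]`. -/
abbrev D (n : ℕ) : Type := MvPolynomial (Fin n) ℝ

/-- `R = ℝ[x_1, …, x_n]`. -/
abbrev R (n : ℕ) : Type := MvPolynomial (Fin n) ℝ

/-- The action of `D` on `R` by differential operators: the linear map that sends a monomial
`d_1 ^ α_1 ⋯ d_n ^ α_n` to `(∂/∂x_1) ^ α_1 ∘ ⋯ ∘ (∂/∂x_n) ^ α_n`. -/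
def diffOp (n : ℕ) : D n →ₗ[ℝ] Module.End ℝ (R n) :=
  (MvPolynomial.basisMonomials (Fin n) ℝ).constr ℝ fun α : Fin n →₀ ℕ =>
    ((List.finRange n).map fun i =>
      ((MvPolynomial.pderiv i).toLinearMap : Module.End ℝ (R n)) ^ α i).prod

/-- The pairing `(d, f) = (d · f)(0)` between `D` and `R`. -/
def evalPairing (n : ℕ) : D n →ₗ[ℝ] R n →ₗ[ℝ] ℝ :=
  (diffOp n).compr₂ (MvPolynomial.aeval (fun _ : Fin n => (0 : ℝ))).toLinearMap

/-- The bilinear form on all of `D ⊗ R` with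
`⟨d ⊗ f, d' ⊗ f'⟩ = (d, f') (d', f)`. -/
def ambientPairing (n : ℕ) : (D n ⊗[ℝ] R n) →ₗ[ℝ] (D n ⊗[ℝ] R n) →ₗ[ℝ] ℝ :=
  TensorProduct.dualDistrib ℝ (D n) (R n) ∘ₗ
    TensorProduct.map (evalPairing n).flip (evalPairing n) ∘ₗ
      (TensorProduct.comm ℝ (D n) (R n)).toLinearMap

theorem ambientPairing_tmul (n : ℕ) (d d' : D n) (f f' : R n) :
    ambientPairing n (d ⊗ₜ[ℝ] f) (d' ⊗ₜ[ℝ] f') = evalPairing n d f' * evalPairing n d' f := by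
  simp [ambientPairing, mul_comm]

/-- `∑ i, d_i ⊗ ∂/∂x_i` on all of `D ⊗ R`, where `d_i` acts by multiplication. -/
def ambientL (n : ℕ) : Module.End ℝ (D n ⊗[ℝ] R n) :=
  ∑ i : Fin n, TensorProduct.map (LinearMap.mulLeft ℝ (MvPolynomial.X i : D n))
    (MvPolynomial.pderiv i).toLinearMap

/-- `S_n` acts on a polynomial ring in `n` variables by permuting the indices. -/
def permRep (n : ℕ) : Representation ℝ (Equiv.Perm (Fin n)) (MvPolynomial (Fin n) ℝ) where
  toFun σ := (MvPolynomial.rename σ).toLinearMap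
  map_one' := LinearMap.ext fun p => by simp
  map_mul' σ τ := LinearMap.ext fun p => by
    simp [MvPolynomial.rename_rename, Equiv.Perm.coe_mul]

/-- The diagonal action of `S_n` on `D ⊗ R`. -/
def ambientRep (n : ℕ) : Representation ℝ (Equiv.Perm (Fin n)) (D n ⊗[ℝ] R n) :=
  (permRep n).tprod (permRep n)

/-- `D^i ⊗ R^j` as a subspace of `D ⊗ R`, where upper indices denote homogeneous pieces. -/
def bidegree (n i j : ℕ) : Submodule ℝ (D n ⊗[ℝ] R n) :=
  LinearMap.range (TensorProduct.map
    (MvPolynomial.homogeneousSubmodule (Fin n) ℝ i).subtype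
    (MvPolynomial.homogeneousSubmodule (Fin n) ℝ j).subtype)

/-- The degree `k` piece of `H_{n,m}` inside `D ⊗ R`: it is `D^i ⊗ R^{m-i}` if `k = -m + 2 i`
for some `0 ≤ i ≤ m` (such an `i` is unique), and zero otherwise. -/
def ambientPiece (n m : ℕ) (k : ℤ) : Submodule ℝ (D n ⊗[ℝ] R n) :=
  ⨆ (i : ℕ) (_ : i ≤ m ∧ k = -(m : ℤ) + 2 * i), bidegree n i (m - i)

/-- `H_{n,m}`, the sum of the `D^i ⊗ R^{m-i}` for `0 ≤ i ≤ m`, as a subspace of `D ⊗ R`. -/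
def carrier (n m : ℕ) : Submodule ℝ (D n ⊗[ℝ] R n) :=
  ⨆ i : Fin (m + 1), bidegree n i (m - i)

/-- The graded vector space `H_{n,m}`. -/
abbrev H (n m : ℕ) : Type := carrier n m

/-- The graded piece `H_{n,m}^k` as a subspace of `H_{n,m}`. -/
def piece (n m : ℕ) (k : ℤ) : Submodule ℝ (H n m) :=
  (ambientPiece n m k).submoduleOf (carrier n m)

theorem tmul_mem_bidegree {n i j : ℕ} {d : D n} {f : R n} (hd : d.IsHomogeneous i)
    (hf : f.IsHomogeneous j) : d ⊗ₜ[ℝ] f ∈ bidegree n i j :=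
  ⟨(⟨d, hd⟩ : MvPolynomial.homogeneousSubmodule (Fin n) ℝ i) ⊗ₜ[ℝ]
    (⟨f, hf⟩ : MvPolynomial.homogeneousSubmodule (Fin n) ℝ j), by simp⟩

theorem bidegree_le {n i j : ℕ} {S : Submodule ℝ (D n ⊗[ℝ] R n)}
    (h : ∀ (d : D n) (f : R n), d.IsHomogeneous i → f.IsHomogeneous j → d ⊗ₜ[ℝ] f ∈ S) :
    bidegree n i j ≤ S := by
  rintro _ ⟨t, rfl⟩
  induction t with
  | zero => simp
  | tmul d f => simpa using h d f d.2 f.2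
  | add a b ha hb => rw [map_add]; exact S.add_mem ha hb

theorem ambientL_mem_carrier {n m : ℕ} :
    ∀ v ∈ carrier n m, ambientL n v ∈ carrier n m := by
  suffices h : carrier n m ≤ (carrier n m).comap (ambientL n) from fun v hv => h hv
  refine iSup_le fun i => bidegree_le fun d f hd hf => ?_
  rw [Submodule.mem_comap, ambientL, LinearMap.sum_apply]
  refine Submodule.sum_mem _ fun k _ => ?_
  rw [TensorProduct.map_tmul]
  rcases (Nat.lt_succ_iff.mp i.2).lt_or_eq with hi | hi
  · refine le_iSup (fun i : Fin (m + 1) => bidegree n i (m - i)) ⟨i + 1, by omega⟩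
      (tmul_mem_bidegree ?_ ?_)
    · have := (MvPolynomial.isHomogeneous_X ℝ k).mul hd
      rwa [add_comm] at this
    · have := hf.pderiv (i := k)
      rwa [Nat.sub_sub] at this
  · have h0 : f.totalDegree = 0 := by
      have := hf.totalDegree_le
      omega
    rw [MvPolynomial.totalDegree_eq_zero_iff_eq_C.mp h0]
    simp

theorem ambientRep_mem_carrier {n m : ℕ} (σ : Equiv.Perm (Fin n)) :
    ∀ v ∈ carrier n m, ambientRep n σ v ∈ carrier n m := by
  suffices h : carrier n m ≤ (carrier n m).comap (ambientRep n σ) from fun v hv => h hv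
  refine iSup_le fun i => bidegree_le fun d f hd hf => ?_
  exact le_iSup (fun i : Fin (m + 1) => bidegree n i (m - i)) i
    (tmul_mem_bidegree hd.rename_isHomogeneous hf.rename_isHomogeneous)

/-- The pairing on `H_{n,m}`. -/
def pairing (n m : ℕ) : H n m →ₗ[ℝ] H n m →ₗ[ℝ] ℝ :=
  (ambientPairing n).domRestrict₁₂ (carrier n m) (carrier n m)

/-- The operator `L = ∑ i, d_i ⊗ ∂/∂x_i` on `H_{n,m}`. -/
def L (n m : ℕ) : Module.End ℝ (H n m) :=
  (ambientL n).restrict ambientL_mem_carrier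

/-- The action of `S_n` on `H_{n,m}`. -/
def rep (n m : ℕ) : Representation ℝ (Equiv.Perm (Fin n)) (H n m) where
  toFun σ := (ambientRep n σ).restrict (ambientRep_mem_carrier σ)
  map_one' := by ext1 v; apply Subtype.ext; simp [LinearMap.restrict_apply]
  map_mul' σ τ := by ext1 v; apply Subtype.ext; simp [LinearMap.restrict_apply]

end

end HomCohom

open KahlerPackage HomCohom

open KahlerPackage HomCohom

namespace HomCohom

noncomputable section

open MvPolynomial Finset

/-! Everything rests on an explicit `sl₂`-action. With `F = ∑ ∂/∂d_i ⊗ x_i` (`lowering`), the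
commutator `[L, F]` acts on `D^i ⊗ R^j` by the scalar `i - j` (Euler's identity), so the grading of
`H` is the weight grading.

Regard an element `a` of `D ⊗ R` as a polynomial function `a(u, v)`. Then `L` and `F` generate the
flows `a(u, v + t u)` and `a(u + t v, v)`. If `F a = 0` and `a` has bidegree `(i, i + r)`,
invariance under the second flow and homogeneity give `a(u, v + t u) = (-1)^i t^r a(v, u + t⁻¹ v)`.
Comparing coefficients of `t^r` yields `L^r a = (-1)^i r! · swap a`
(`ambientL_pow_of_lowering_eq_zero`).

The form `⟨a, swap b⟩` is diagonal and positive on monomials (`ambientPairing_swap_pos`). This gives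
non-degeneracy and, since primitive vectors are killed by `F`, the Hodge–Riemann relations with
their sign. Injectivity of `L^r` in weight `-r` follows by induction on `i`: if `L^r a = 0`, then `F
a` is killed by `L^(r+2)`, so `F a = 0` and the swap formula forces `a = 0`. The swap also equates
the dimensions of opposite weights, whence surjectivity. -/

/-! ### The differentiation pairing on monomials. -/

theorem pderiv_pderiv_comm {σ : Type*} (i j : σ) :
    Commute ((pderiv i).toLinearMap : Module.End ℝ (MvPolynomial σ ℝ))
      (pderiv j).toLinearMap := by
  classical
  -- A commutator of derivations is a derivation, so it suffices to test it on the variables.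
  have h : ⁅(pderiv i : Derivation ℝ (MvPolynomial σ ℝ) _), pderiv j⁆ = 0 :=
    derivation_ext fun k => by
      rw [Derivation.commutator_apply, pderiv_X, pderiv_X]
      simp only [Pi.single_apply]
      split_ifs <;> simp
  refine LinearMap.ext fun p => ?_
  have := congrArg (fun D => D p) h
  rw [Derivation.commutator_apply] at this
  exact sub_eq_zero.mp this

/-- `diffOp` is an ordered product in a noncommutative monoid; since the factors commute, one extra
factor can be moved to the right end. -/
theorem list_prod_pow_add_single {M ι : Type*} [Monoid M] [DecidableEq ι] (P : ι → M)
    (hP : ∀ i j, Commute (P i) (P j)) (α : ι →₀ ℕ) (i : ι) (l : List ι) (hl : l.Nodup) :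
    (l.map fun j => P j ^ ((α + Finsupp.single i 1 : ι →₀ ℕ) j)).prod =
      (l.map fun j => P j ^ α j).prod * if i ∈ l then P i else 1 := by
  induction l with
  | nil => simp
  | cons a l ih =>
    rw [List.nodup_cons] at hl
    rw [List.map_cons, List.prod_cons, ih hl.2, List.map_cons, List.prod_cons]
    by_cases hai : i = a
    · subst hai
      have hc : Commute (P i) (l.map fun j => P j ^ α j).prod :=
        Commute.list_prod_right _ _ fun x hx => by
          obtain ⟨j, -, rfl⟩ := List.mem_map.mp hx
          exact (hP i j).pow_right _
      simp only [hl.1, if_false, mul_one, Finsupp.add_apply, Finsupp.single_eq_same,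
        List.mem_cons, true_or, if_true, pow_succ]
      rw [mul_assoc, mul_assoc, hc.eq]
    · simp [hai, mul_assoc]

theorem diffOp_X_mul {n : ℕ} (i : Fin n) (d : D n) :
    diffOp n (X i * d) = diffOp n d * (pderiv i).toLinearMap := by
  induction d using MvPolynomial.induction_on' with
  | monomial α a =>
    have key : ∀ (α : Fin n →₀ ℕ) (a : ℝ), diffOp n (monomial α a) =
        a • ((List.finRange n).map fun i =>
          ((pderiv i).toLinearMap : Module.End ℝ (R n)) ^ α i).prod := fun α a => by
      have : monomial α a = a • basisMonomials (Fin n) ℝ α := by simp [smul_monomial]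
      rw [this, map_smul, diffOp, Module.Basis.constr_basis]
    rw [mul_comm, X, monomial_mul, mul_one, key, key,
      list_prod_pow_add_single _ pderiv_pderiv_comm _ _ _ (List.nodup_finRange n),
      if_pos (List.mem_finRange i), smul_mul_assoc]
  | add p q hp hq => rw [mul_add, map_add, hp, hq, map_add, add_mul]

/-- Adjointness of `d_i` and `∂/∂x_i` is the source of the self-adjointness of `L`. -/
theorem evalPairing_X_mul {n : ℕ} (i : Fin n) (d : D n) (f : R n) :
    evalPairing n (X i * d) f = evalPairing n d (pderiv i f) := by
  simp only [evalPairing, LinearMap.compr₂_apply, diffOp_X_mul]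
  rfl

/-- Removing one variable at a time, each derivative contributes the current exponent, and these
accumulate to the factorials. Thus monomials are orthogonal with positive norms. -/
theorem evalPairing_monomial_one {n : ℕ} (α : Fin n →₀ ℕ) (f : R n) :
    evalPairing n (monomial α 1) f = (∏ i, ((α i).factorial : ℝ)) * coeff α f := by
  have step : ∀ (i : Fin n) (α : Fin n →₀ ℕ),
      (∀ f, evalPairing n (monomial α 1) f = (∏ i, ((α i).factorial : ℝ)) * coeff α f) →
      ∀ f, evalPairing n (monomial (α + Finsupp.single i 1) 1) f =
        (∏ j, (((α + Finsupp.single i 1 : Fin n →₀ ℕ) j).factorial : ℝ)) *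
          coeff (α + Finsupp.single i 1) f := fun i α h f => by
    have hm : (monomial (α + Finsupp.single i 1) 1 : D n) = X i * monomial α 1 := by
      rw [X, monomial_mul, one_mul, add_comm]
    rw [hm, evalPairing_X_mul, h, coeff_pderiv, mul_comm (coeff _ _), ← mul_assoc]
    congr 1
    rw [← mul_prod_erase univ _ (mem_univ i), ← mul_prod_erase univ _ (mem_univ i)]
    have : ∀ j ∈ univ.erase i,
        (((α + Finsupp.single i 1 : Fin n →₀ ℕ) j).factorial : ℝ) = (α j).factorial :=
      fun j hj => by simp [(ne_of_mem_erase hj)]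
    rw [prod_congr rfl this, Finsupp.add_apply, Finsupp.single_eq_same, Nat.factorial_succ]
    push_cast
    ring
  induction α using Finsupp.induction generalizing f with
  | zero =>
    have : diffOp n (monomial 0 1) = 1 := by
      have : (monomial 0 1 : D n) = basisMonomials (Fin n) ℝ 0 := by simp
      rw [this, diffOp, Module.Basis.constr_basis]
      simp
    rw [evalPairing, LinearMap.compr₂_apply, this]
    simp [← constantCoeff_eq]
  | single_add i k α _ _ h =>
    induction k generalizing f with
    | zero => simpa using h f
    | succ k ih =>
      rw [Finsupp.single_add, add_right_comm]
      -- The inner hypothesis is available only for nonzero exponents, so exponent one is reached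
      -- from `h` instead.
      rcases eq_or_ne k 0 with rfl | hk
      · exact step i _ (fun f => by simpa using h f) f
      · exact step i _ (fun f => ih hk f) f

theorem evalPairing_monomial {n : ℕ} (α : Fin n →₀ ℕ) (a : ℝ) (f : R n) :
    evalPairing n (monomial α a) f = a * (∏ i, ((α i).factorial : ℝ)) * coeff α f := by
  have : (monomial α a : D n) = a • monomial α 1 := by simp [smul_monomial]
  rw [this, map_smul, LinearMap.smul_apply, evalPairing_monomial_one, smul_eq_mul, mul_assoc]

theorem evalPairing_permRep {n : ℕ} (σ : Equiv.Perm (Fin n)) (d : D n) (f : R n) :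
    evalPairing n (permRep n σ d) (permRep n σ f) = evalPairing n d f := by
  change evalPairing n (rename σ d) (rename σ f) = _
  induction d using MvPolynomial.induction_on' with
  | monomial α a =>
    rw [rename_monomial, evalPairing_monomial, evalPairing_monomial,
      coeff_rename_mapDomain _ σ.injective,
      ← Equiv.prod_comp σ (fun i => ((Finsupp.mapDomain σ α i).factorial : ℝ))]
    simp [Finsupp.mapDomain_apply σ.injective]
  | add p q hp hq => simp only [map_add, LinearMap.add_apply, hp, hq]

theorem evalPairing_eq_zero {n i j : ℕ} {d : D n} {f : R n} (hd : d.IsHomogeneous i)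
    (hf : f.IsHomogeneous j) (hij : i ≠ j) : evalPairing n d f = 0 := by
  rw [d.as_sum, map_sum, LinearMap.sum_apply]
  refine sum_eq_zero fun α hα => ?_
  rw [evalPairing_monomial, hf.coeff_eq_zero, mul_zero]
  rw [Finsupp.degree_apply, ← hd.degree_eq_sum_deg_support hα]
  exact hij

/-! ### Positivity -/

theorem bilin_pos_of_orthogonal_basis {ι V : Type*} [AddCommGroup V] [Module ℝ V]
    (b : Module.Basis ι ℝ V) (B : V →ₗ[ℝ] V →ₗ[ℝ] ℝ) (h₀ : ∀ i j, i ≠ j → B (b i) (b j) = 0)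
    (h₁ : ∀ i, 0 < B (b i) (b i)) {v : V} (hv : v ≠ 0) : 0 < B v v := by
  rw [← LinearMap.sum_repr_mul_repr_mul b b]
  have : ∀ i ∈ (b.repr v).support, ((b.repr v).sum fun j c => b.repr v i • c • B (b i) (b j)) =
      b.repr v i ^ 2 * B (b i) (b i) := fun i hi => by
    rw [Finsupp.sum, sum_eq_single i]
    · simp only [smul_eq_mul]; ring
    · intro j _ hj; simp [h₀ i j hj.symm]
    · intro h; exact absurd hi h
  rw [Finsupp.sum, sum_congr rfl this]
  refine sum_pos (fun i hi => mul_pos ?_ (h₁ i)) ?_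
  · have := Finsupp.mem_support_iff.mp hi
    positivity
  · rw [Finsupp.support_nonempty_iff]
    simpa using hv

/-- The exchange of the two tensor factors. -/
abbrev swap (n : ℕ) : (D n ⊗[ℝ] R n) ≃ₗ[ℝ] (D n ⊗[ℝ] R n) := TensorProduct.comm ℝ (D n) (R n)

/-- Composing with the swap turns the pairing into the tensor square of the differentiation form,
whose matrix in the monomial basis is diagonal with entries `α! β!`. -/
theorem ambientPairing_swap_pos {n : ℕ} {a : D n ⊗[ℝ] R n} (ha : a ≠ 0) :
    0 < ambientPairing n a (swap n a) := by
  let b := (basisMonomials (Fin n) ℝ).tensorProduct (basisMonomials (Fin n) ℝ)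
  have key : ∀ p q, (ambientPairing n).compl₂ (swap n).toLinearMap (b p) (b q) =
      (∏ i, ((p.1 i).factorial : ℝ)) * coeff p.1 (monomial q.1 (1 : ℝ)) *
        ((∏ i, ((q.2 i).factorial : ℝ)) * coeff q.2 (monomial p.2 (1 : ℝ))) := fun p q => by
    rw [LinearMap.compl₂_apply, LinearEquiv.coe_coe, Module.Basis.tensorProduct_apply',
      Module.Basis.tensorProduct_apply', TensorProduct.comm_tmul, ambientPairing_tmul]
    simp only [coe_basisMonomials, evalPairing_monomial_one]
  refine bilin_pos_of_orthogonal_basis b ((ambientPairing n).compl₂ (swap n).toLinearMap)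
    (fun p q hpq => ?_) (fun p => ?_) ha
  · rw [key, coeff_monomial, coeff_monomial]
    by_cases h₁ : q.1 = p.1
    · rw [if_neg (fun h₂ => hpq (Prod.ext h₁.symm h₂)), mul_zero, mul_zero]
    · rw [if_neg h₁, mul_zero, zero_mul]
  · rw [key, coeff_monomial, coeff_monomial, if_pos rfl, if_pos rfl]
    positivity

/-! ### The lowering operator and the weights -/

/-- The operator `∑ i, ∂/∂d_i ⊗ x_i` on `D ⊗ R`, opposite to `ambientL`. -/
def lowering (n : ℕ) : Module.End ℝ (D n ⊗[ℝ] R n) :=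
  ∑ i : Fin n, TensorProduct.map (pderiv i).toLinearMap (LinearMap.mulLeft ℝ (X i : R n))

theorem ambientL_tmul {n : ℕ} (d : D n) (f : R n) :
    ambientL n (d ⊗ₜ f) = ∑ i, (X i * d) ⊗ₜ[ℝ] pderiv i f := by
  simp [ambientL, LinearMap.sum_apply]

theorem lowering_tmul {n : ℕ} (d : D n) (f : R n) :
    lowering n (d ⊗ₜ f) = ∑ i, pderiv i d ⊗ₜ[ℝ] (X i * f) := by
  simp [lowering, LinearMap.sum_apply]

/-- Terms with distinct indices cancel; in the diagonal ones the product rule leaves the difference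
of the two Euler operators. -/
theorem commutator_tmul {n : ℕ} (d : D n) (f : R n) :
    (ambientL n * lowering n - lowering n * ambientL n) (d ⊗ₜ f) =
      (∑ i, X i * pderiv i d) ⊗ₜ[ℝ] f - d ⊗ₜ[ℝ] ∑ i, X i * pderiv i f := by
  classical
  rw [LinearMap.sub_apply, Module.End.mul_apply, Module.End.mul_apply, lowering_tmul,
    ambientL_tmul, map_sum, map_sum]
  simp only [lowering_tmul, ambientL_tmul]
  rw [sum_comm, TensorProduct.sum_tmul, TensorProduct.tmul_sum, ← sum_sub_distrib,
    ← sum_sub_distrib]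
  refine sum_congr rfl fun j _ => ?_
  rw [← sum_sub_distrib, sum_eq_single j]
  · rw [pderiv_mul, pderiv_mul, pderiv_X_self, one_mul, one_mul, TensorProduct.tmul_add,
      TensorProduct.add_tmul]
    abel
  · intro i _ hij
    rw [pderiv_mul, pderiv_mul, pderiv_X_of_ne hij, pderiv_X_of_ne hij.symm, zero_mul, zero_mul,
      zero_add, zero_add, sub_self]
  · simp

theorem commutator_apply_of_mem {n i j : ℕ} {a : D n ⊗[ℝ] R n} (ha : a ∈ bidegree n i j) :
    (ambientL n * lowering n - lowering n * ambientL n) a = ((i : ℝ) - j) • a := by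
  have h : bidegree n i j ≤
      Module.End.eigenspace (ambientL n * lowering n - lowering n * ambientL n) ((i : ℝ) - j) :=
    bidegree_le fun d f hd hf => by
      rw [Module.End.mem_eigenspace_iff, commutator_tmul, hd.sum_X_mul_pderiv,
        hf.sum_X_mul_pderiv, sub_smul]
      simp only [← Nat.cast_smul_eq_nsmul ℝ, TensorProduct.smul_tmul', TensorProduct.tmul_smul]
  exact Module.End.mem_eigenspace_iff.mp (h ha)

theorem pderiv_eq_zero_of_isHomogeneous_zero {σ : Type*} {f : MvPolynomial σ ℝ}
    (hf : f.IsHomogeneous 0) (i : σ) : pderiv i f = 0 := by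
  rw [totalDegree_eq_zero_iff_eq_C.mp (Nat.le_zero.mp hf.totalDegree_le), pderiv_C]

theorem ambientL_mem_bidegree {n i j : ℕ} {a : D n ⊗[ℝ] R n} (ha : a ∈ bidegree n i (j + 1)) :
    ambientL n a ∈ bidegree n (i + 1) j := by
  have h : bidegree n i (j + 1) ≤ (bidegree n (i + 1) j).comap (ambientL n) :=
    bidegree_le fun d f hd hf => by
      rw [Submodule.mem_comap, ambientL_tmul]
      refine Submodule.sum_mem _ fun k _ => tmul_mem_bidegree ?_ (hf.pderiv (i := k))
      rw [add_comm]
      exact (isHomogeneous_X ℝ k).mul hd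
  exact h ha

theorem ambientL_eq_zero {n i : ℕ} {a : D n ⊗[ℝ] R n} (ha : a ∈ bidegree n i 0) :
    ambientL n a = 0 := by
  have h : bidegree n i 0 ≤ LinearMap.ker (ambientL n) := bidegree_le fun d f hd hf => by
    rw [LinearMap.mem_ker, ambientL_tmul]
    exact sum_eq_zero fun k _ => by
      rw [pderiv_eq_zero_of_isHomogeneous_zero hf, TensorProduct.tmul_zero]
  exact h ha

theorem lowering_mem_bidegree {n i j : ℕ} {a : D n ⊗[ℝ] R n} (ha : a ∈ bidegree n (i + 1) j) :
    lowering n a ∈ bidegree n i (j + 1) := by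
  have h : bidegree n (i + 1) j ≤ (bidegree n i (j + 1)).comap (lowering n) :=
    bidegree_le fun d f hd hf => by
      rw [Submodule.mem_comap, lowering_tmul]
      refine Submodule.sum_mem _ fun k _ => tmul_mem_bidegree (hd.pderiv (i := k)) ?_
      rw [add_comm]
      exact (isHomogeneous_X ℝ k).mul hf
  exact h ha

theorem lowering_eq_zero {n j : ℕ} {a : D n ⊗[ℝ] R n} (ha : a ∈ bidegree n 0 j) :
    lowering n a = 0 := by
  have h : bidegree n 0 j ≤ LinearMap.ker (lowering n) := bidegree_le fun d f hd hf => by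
    rw [LinearMap.mem_ker, lowering_tmul]
    exact sum_eq_zero fun k _ => by
      rw [pderiv_eq_zero_of_isHomogeneous_zero hd, TensorProduct.zero_tmul]
  exact h ha

theorem swap_mem_bidegree {n i j : ℕ} {a : D n ⊗[ℝ] R n} (ha : a ∈ bidegree n i j) :
    swap n a ∈ bidegree n j i := by
  have h : bidegree n i j ≤ (bidegree n j i).comap (swap n).toLinearMap :=
    bidegree_le fun d f hd hf => tmul_mem_bidegree hf hd
  exact h ha

/-! ### Weights and the `sl₂` commutation relations. -/

theorem ambientPiece_le {n m : ℕ} {k : ℤ} {S : Submodule ℝ (D n ⊗[ℝ] R n)}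
    (h : ∀ i j : ℕ, i + j = m → k = (i : ℤ) - j → bidegree n i j ≤ S) :
    ambientPiece n m k ≤ S :=
  iSup₂_le fun i hi => h i (m - i) (by omega) (by omega)

theorem bidegree_le_ambientPiece {n m i j : ℕ} {k : ℤ} (hm : i + j = m) (hk : k = (i : ℤ) - j) :
    bidegree n i j ≤ ambientPiece n m k := by
  obtain rfl : j = m - i := by omega
  exact le_iSup₂_of_le (f := fun i (_ : i ≤ m ∧ k = -(m : ℤ) + 2 * i) => bidegree n i (m - i))
    i ⟨by omega, by omega⟩ le_rfl

theorem ambientPiece_eq {n m i j : ℕ} {k : ℤ} (hm : i + j = m) (hk : k = (i : ℤ) - j) :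
    ambientPiece n m k = bidegree n i j := by
  refine le_antisymm (ambientPiece_le fun i' j' hm' hk' => ?_) (bidegree_le_ambientPiece hm hk)
  obtain rfl : i' = i := by omega
  obtain rfl : j' = j := by omega
  exact le_rfl

theorem ambientL_mem_ambientPiece {n m : ℕ} {k : ℤ} {a : D n ⊗[ℝ] R n}
    (ha : a ∈ ambientPiece n m k) : ambientL n a ∈ ambientPiece n m (k + 2) := by
  have h : ambientPiece n m k ≤ (ambientPiece n m (k + 2)).comap (ambientL n) :=
    ambientPiece_le fun i j hm hk a ha => by
      rw [Submodule.mem_comap]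
      cases j with
      | zero => rw [ambientL_eq_zero ha]; exact Submodule.zero_mem _
      | succ j =>
        exact bidegree_le_ambientPiece (by omega) (by push_cast at *; omega)
          (ambientL_mem_bidegree ha)
  exact h ha

theorem ambientL_pow_mem_ambientPiece {n m : ℕ} {k : ℤ} {a : D n ⊗[ℝ] R n}
    (ha : a ∈ ambientPiece n m k) (r : ℕ) :
    (ambientL n ^ r) a ∈ ambientPiece n m (k + 2 * r) := by
  induction r with
  | zero => simpa using ha
  | succ r ih =>
    rw [pow_succ', Module.End.mul_apply]
    rw [show k + 2 * ((r + 1 : ℕ) : ℤ) = k + 2 * r + 2 by push_cast; ring]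
    exact ambientL_mem_ambientPiece ih

theorem commutator_apply_of_mem_ambientPiece {n m : ℕ} {k : ℤ} {a : D n ⊗[ℝ] R n}
    (ha : a ∈ ambientPiece n m k) :
    (ambientL n * lowering n - lowering n * ambientL n) a = (k : ℝ) • a := by
  have h : ambientPiece n m k ≤
      Module.End.eigenspace (ambientL n * lowering n - lowering n * ambientL n) (k : ℝ) :=
    ambientPiece_le fun i j hm hk a ha => by
      rw [Module.End.mem_eigenspace_iff, commutator_apply_of_mem ha, hk]
      push_cast
      rfl
  exact Module.End.mem_eigenspace_iff.mp (h ha)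

/-- Moving `F` past each `E` costs the weight at that point of the string; the coefficient is the
sum of `w + 2 j` over `0 ≤ j ≤ k`. -/
theorem pow_succ_apply_of_commutator {V : Type*} [AddCommGroup V] [Module ℝ V]
    (E F : Module.End ℝ V) (w : ℝ) (a : V)
    (h : ∀ j : ℕ, (E * F - F * E) ((E ^ j) a) = (w + 2 * j) • (E ^ j) a) (k : ℕ) :
    (E ^ (k + 1)) (F a) = F ((E ^ (k + 1)) a) + ((k + 1) * (w + k)) • (E ^ k) a := by
  have h' : ∀ j : ℕ, E (F ((E ^ j) a)) = F (E ((E ^ j) a)) + (w + 2 * j) • (E ^ j) a :=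
    fun j => by rw [← h j]; simp
  induction k with
  | zero => simpa using h' 0
  | succ k ih =>
    rw [pow_succ', Module.End.mul_apply, ih, map_add, map_smul, h',
      ← Module.End.mul_apply E, ← Module.End.mul_apply E, ← pow_succ', ← pow_succ', add_assoc, ← add_smul,
      show w + 2 * ((k + 1 : ℕ) : ℝ) + (k + 1) * (w + k) =
        (((k + 1 : ℕ) : ℝ) + 1) * (w + ((k + 1 : ℕ) : ℝ)) by push_cast; ring]

/-- For `a` of weight `-r`, the operator `L ^ (r + 1)` commutes with the lowering operator. -/
theorem ambientL_pow_succ_lowering {n m r : ℕ} {a : D n ⊗[ℝ] R n}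
    (ha : a ∈ ambientPiece n m (-(r : ℤ))) :
    (ambientL n ^ (r + 1)) (lowering n a) = lowering n ((ambientL n ^ (r + 1)) a) := by
  -- For `w = -r` and `k = r` the coefficient `(k + 1) (w + k)` vanishes.
  rw [pow_succ_apply_of_commutator (ambientL n) (lowering n) (-(r : ℝ)) a (fun j => ?_) r]
  · simp
  · rw [commutator_apply_of_mem_ambientPiece (ambientL_pow_mem_ambientPiece ha j)]
    push_cast
    rfl

/-! ### Evaluation of elements of `D ⊗ R` -/

/-- Evaluation of `D ⊗ R` at a pair of points with coordinates in an algebra. -/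
def evalAt {n : ℕ} {A : Type*} [CommRing A] [Algebra ℝ A] (φ ψ : Fin n → A) :
    (D n ⊗[ℝ] R n) →ₐ[ℝ] A :=
  Algebra.TensorProduct.productMap (aeval φ) (aeval ψ)

theorem evalAt_tmul {n : ℕ} {A : Type*} [CommRing A] [Algebra ℝ A] (φ ψ : Fin n → A)
    (d : D n) (f : R n) : evalAt φ ψ (d ⊗ₜ f) = aeval φ d * aeval ψ f := rfl

theorem map_evalAt {n : ℕ} {A B : Type*} [CommRing A] [Algebra ℝ A] [CommRing B] [Algebra ℝ B]
    (g : A →ₐ[ℝ] B) (φ ψ : Fin n → A) (a : D n ⊗[ℝ] R n) :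
    g (evalAt φ ψ a) = evalAt (fun i => g (φ i)) (fun i => g (ψ i)) a := by
  induction a with
  | zero => simp
  | tmul d f => rw [evalAt_tmul, evalAt_tmul, map_mul, comp_aeval_apply, comp_aeval_apply]
  | add a b ha hb => rw [map_add, map_add, ha, hb, map_add]

theorem evalAt_swap {n : ℕ} {A : Type*} [CommRing A] [Algebra ℝ A] (φ ψ : Fin n → A)
    (a : D n ⊗[ℝ] R n) : evalAt φ ψ (swap n a) = evalAt ψ φ a := by
  induction a with
  | zero => simp
  | tmul d f => rw [TensorProduct.comm_tmul, evalAt_tmul, evalAt_tmul, mul_comm]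
  | add a b ha hb => rw [map_add, map_add, ha, hb, map_add]

/-- `D ⊗ R` is a polynomial ring in `2n` variables over an infinite field, so values determine its
elements. -/
theorem ext_of_evalAt {n : ℕ} {a b : D n ⊗[ℝ] R n}
    (h : ∀ u v : Fin n → ℝ, evalAt u v a = evalAt u v b) : a = b := by
  have key : ∀ (w : Fin n ⊕ Fin n → ℝ) (c : D n ⊗[ℝ] R n),
      eval w (tensorEquivSum ℝ (Fin n) (Fin n) ℝ c) =
        evalAt (fun i => w (.inl i)) (fun i => w (.inr i)) c := fun w c => by
    have : ((aeval w).comp (tensorEquivSum ℝ (Fin n) (Fin n) ℝ).toAlgHom) =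
        evalAt (fun i => w (.inl i)) (fun i => w (.inr i)) := by
      ext i <;> simp [evalAt]
    exact DFunLike.congr_fun this c
  apply (tensorEquivSum ℝ (Fin n) (Fin n) ℝ).injective
  exact MvPolynomial.funext fun w => by rw [key, key, h]

theorem aeval_smul_of_isHomogeneous {n i : ℕ} {f : R n} (hf : f.IsHomogeneous i) (c : ℝ)
    (u : Fin n → ℝ) : aeval (c • u) f = c ^ i * aeval u f := by
  rw [f.as_sum, map_sum, map_sum, mul_sum]
  refine sum_congr rfl fun α hα => ?_
  rw [aeval_monomial, aeval_monomial, hf.degree_eq_sum_deg_support hα]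
  simp only [Pi.smul_apply, smul_eq_mul, mul_pow, Finsupp.prod, prod_mul_distrib, prod_pow_eq_pow_sum]
  ring

theorem evalAt_smul_smul {n i j : ℕ} {a : D n ⊗[ℝ] R n} (ha : a ∈ bidegree n i j) (c e : ℝ)
    (u v : Fin n → ℝ) : evalAt (c • u) (e • v) a = c ^ i * e ^ j * evalAt u v a := by
  have h : bidegree n i j ≤ LinearMap.eqLocus (evalAt (c • u) (e • v)).toLinearMap
      ((c ^ i * e ^ j) • (evalAt u v).toLinearMap) := bidegree_le fun d f hd hf => by
    change aeval (c • u) d * aeval (e • v) f = c ^ i * e ^ j * (aeval u d * aeval v f)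
    rw [aeval_smul_of_isHomogeneous hd, aeval_smul_of_isHomogeneous hf]
    ring
  exact h ha

theorem derivative_aeval {n : ℕ} (g : Fin n → Polynomial ℝ) (f : R n) :
    Polynomial.derivative (aeval g f) =
      ∑ i, aeval g (pderiv i f) * Polynomial.derivative (g i) := by
  classical
  induction f using MvPolynomial.induction_on with
  | C a => simp
  | add p q hp hq => simp only [map_add, hp, hq, add_mul, sum_add_distrib]
  | mul_X p j hp =>
    rw [map_mul, Polynomial.derivative_mul, hp, aeval_X, sum_mul]
    have hj : aeval g p * Polynomial.derivative (g j) =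
        ∑ i, aeval g p * aeval g (pderiv i (X j : R n)) * Polynomial.derivative (g i) := by
      rw [sum_eq_single j]
      · rw [pderiv_X_self, map_one, mul_one]
      · intro i _ hij
        rw [pderiv_X_of_ne hij.symm, map_zero, mul_zero, zero_mul]
      · simp
    rw [hj, ← sum_add_distrib]
    exact sum_congr rfl fun i _ => by
      rw [pderiv_mul, map_add, map_mul, map_mul, aeval_X]
      ring

/-- The point `v + t u` of `ℝ[t] ^ n`. -/
def line {n : ℕ} (v u : Fin n → ℝ) (i : Fin n) : Polynomial ℝ :=
  Polynomial.C (v i) + Polynomial.X * Polynomial.C (u i)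

/-- By the chain rule, differentiating `a(u, v + t u)` in `t` yields `∑ u_i ∂a/∂x_i`, and the factor
`u_i` is multiplication by `d_i`. -/
theorem derivative_evalAt_ambientL {n : ℕ} (u v : Fin n → ℝ) (a : D n ⊗[ℝ] R n) :
    Polynomial.derivative (evalAt (fun i => Polynomial.C (u i)) (line v u) a) =
      evalAt (fun i => Polynomial.C (u i)) (line v u) (ambientL n a) := by
  induction a with
  | zero => simp
  | tmul d f =>
    rw [ambientL_tmul, map_sum, evalAt_tmul, Polynomial.derivative_mul, derivative_aeval,
      derivative_aeval, mul_sum]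
    simp only [evalAt_tmul, map_mul, aeval_X, line, Polynomial.derivative_C, mul_zero,
      sum_const_zero, zero_mul, zero_add, Polynomial.derivative_add, Polynomial.derivative_X, one_mul,
      add_zero, Polynomial.derivative_mul]
    exact sum_congr rfl fun i _ => by ring
  | add a b ha hb => rw [map_add, map_add, map_add, map_add, ha, hb]

theorem derivative_evalAt_lowering {n : ℕ} (u v : Fin n → ℝ) (a : D n ⊗[ℝ] R n) :
    Polynomial.derivative (evalAt (line u v) (fun i => Polynomial.C (v i)) a) =
      evalAt (line u v) (fun i => Polynomial.C (v i)) (lowering n a) := by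
  induction a with
  | zero => simp
  | tmul d f =>
    rw [lowering_tmul, map_sum, evalAt_tmul, Polynomial.derivative_mul, derivative_aeval,
      derivative_aeval, sum_mul]
    simp only [evalAt_tmul, map_mul, aeval_X, line, Polynomial.derivative_C, mul_zero,
      sum_const_zero, zero_add, Polynomial.derivative_add, Polynomial.derivative_X, one_mul,
      add_zero, Polynomial.derivative_mul]
    exact sum_congr rfl fun i _ => by ring
  | add a b ha hb => rw [map_add, map_add, map_add, map_add, ha, hb]

theorem eval_evalAt_line {n : ℕ} (u v : Fin n → ℝ) (t : ℝ) (a : D n ⊗[ℝ] R n) :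
    (evalAt (fun i => Polynomial.C (u i)) (line v u) a).eval t = evalAt u (v + t • u) a := by
  have := map_evalAt (Polynomial.aeval t) (fun i => Polynomial.C (u i)) (line v u) a
  rw [← Polynomial.coe_aeval_eq_eval, this]
  congr <;> funext i <;> simp [line, mul_comm t]

theorem eval_evalAt_line_left {n : ℕ} (u v : Fin n → ℝ) (t : ℝ) (a : D n ⊗[ℝ] R n) :
    (evalAt (line u v) (fun i => Polynomial.C (v i)) a).eval t = evalAt (u + t • v) v a := by
  have := map_evalAt (Polynomial.aeval t) (line u v) (fun i => Polynomial.C (v i)) a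
  rw [← Polynomial.coe_aeval_eq_eval, this]
  congr <;> funext i <;> simp [line, mul_comm t]

/-- This is Taylor's formula for the flow of `L`. -/
theorem evalAt_ambientL_pow {n : ℕ} (u v : Fin n → ℝ) (a : D n ⊗[ℝ] R n) (k : ℕ) :
    evalAt u v ((ambientL n ^ k) a) =
      k.factorial * (evalAt (fun i => Polynomial.C (u i)) (line v u) a).coeff k := by
  induction k generalizing a with
  | zero =>
    have := eval_evalAt_line u v 0 a
    rw [zero_smul, add_zero] at this
    simp [← this, Polynomial.coeff_zero_eq_eval_zero]
  | succ k ih =>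
    rw [pow_succ, Module.End.mul_apply, ih, ← derivative_evalAt_ambientL,
      Polynomial.coeff_derivative, Nat.factorial_succ]
    push_cast
    ring

theorem evalAt_add_smul_of_lowering_eq_zero {n : ℕ} {a : D n ⊗[ℝ] R n} (ha : lowering n a = 0)
    (u v : Fin n → ℝ) (t : ℝ) : evalAt (u + t • v) v a = evalAt u v a := by
  have h := derivative_evalAt_lowering u v a
  rw [ha, map_zero] at h
  have h' := Polynomial.eq_C_of_natDegree_eq_zero
    (Polynomial.derivative_eq_zero.mp h)
  have h0 := eval_evalAt_line_left u v 0 a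
  rw [← eval_evalAt_line_left, h', Polynomial.eval_C]
  rw [h', Polynomial.eval_C, zero_smul, add_zero] at h0
  exact h0

/-! ### Lowest weight vectors and primitive vectors. -/

/-- The reversed polynomial of `q` clears the powers of `t⁻¹`, and agreement at infinitely many `t`
makes this a polynomial identity. -/
theorem coeff_eq_of_eval_inv {p q : Polynomial ℝ} {c : ℝ} {r : ℕ}
    (h : ∀ t : ℝ, t ≠ 0 → p.eval t = c * t ^ r * q.eval t⁻¹) : p.coeff r = c * q.coeff 0 := by
  have hpq : p * Polynomial.X ^ q.natDegree =
      Polynomial.C c * (q.reverse * Polynomial.X ^ r) := by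
    refine Polynomial.eq_of_infinite_eval_eq _ _
      ((Set.finite_singleton (0 : ℝ)).infinite_compl.mono fun t ht => ?_)
    have ht : t ≠ 0 := ht
    have := invertibleOfNonzero (inv_ne_zero ht)
    have hr := Polynomial.eval₂_reverse_mul_pow (RingHom.id ℝ) t⁻¹ q
    rw [invOf_eq_inv, inv_inv] at hr
    change q.reverse.eval t * _ = q.eval _ at hr
    simp only [Set.mem_ofPred_eq, Polynomial.eval_mul, Polynomial.eval_pow, Polynomial.eval_X,
      Polynomial.eval_C]
    rw [h t ht, ← hr, inv_pow]
    field_simp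
  have := congrArg (fun f => f.coeff (q.natDegree + r)) hpq
  simp only [Polynomial.coeff_C_mul, Polynomial.coeff_mul_X_pow] at this
  rw [add_comm, Polynomial.coeff_mul_X_pow] at this
  rw [this, Polynomial.coeff_reverse, Polynomial.revAt_le le_rfl, Nat.sub_self]

/-- On lowest weight vectors of weight `-r`, the operator `L ^ r / r!` is the exchange of the
tensor factors up to sign. -/
theorem ambientL_pow_of_lowering_eq_zero {n i r : ℕ} {a : D n ⊗[ℝ] R n}
    (ha : a ∈ bidegree n i (i + r)) (h0 : lowering n a = 0) :
    (ambientL n ^ r) a = ((-1) ^ i * (r.factorial : ℝ)) • swap n a := by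
  refine ext_of_evalAt fun u v => ?_
  rw [evalAt_ambientL_pow, map_smul, evalAt_swap, smul_eq_mul,
    coeff_eq_of_eval_inv (c := (-1) ^ i) (q := evalAt (fun i => Polynomial.C (v i)) (line u v) a),
    Polynomial.coeff_zero_eq_eval_zero, eval_evalAt_line, zero_smul, add_zero]
  · ring
  · intro t ht
    -- The time `-t⁻¹` is chosen so that `u - t⁻¹ (v + t u)` no longer involves `u`. Homogeneity
    -- then extracts `(-t⁻¹)^i t^(i+r) = (-1)^i t^r`.
    rw [eval_evalAt_line, eval_evalAt_line,
      ← evalAt_add_smul_of_lowering_eq_zero h0 u (v + t • u) (-t⁻¹)]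
    have h₁ : u + -t⁻¹ • (v + t • u) = (-t⁻¹) • v := by
      rw [smul_add, smul_smul, neg_mul, inv_mul_cancel₀ ht]; simp
    have h₂ : v + t • u = t • (u + t⁻¹ • v) := by
      rw [smul_add, smul_smul, mul_inv_cancel₀ ht, one_smul, add_comm]
    rw [h₁, h₂, evalAt_smul_smul ha, neg_pow, pow_add, inv_pow]
    field_simp

/-- A vector of weight `-r ≤ 0` killed by `L ^ r` vanishes. -/
theorem eq_zero_of_ambientL_pow_eq_zero {n : ℕ} (i : ℕ) {r : ℕ} {a : D n ⊗[ℝ] R n}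
    (ha : a ∈ bidegree n i (i + r)) (h : (ambientL n ^ r) a = 0) : a = 0 := by
  induction i generalizing r a with
  | zero =>
    have := ambientL_pow_of_lowering_eq_zero ha (lowering_eq_zero (by simpa using ha))
    rw [h] at this
    simpa [Nat.factorial_ne_zero] using this.symm
  | succ i ih =>
    -- Lowering takes weight `-r` to `-(r + 2)` and reduces `i` by one, so the induction hypothesis
    -- applies with `r + 2`.
    have hF : lowering n a ∈ bidegree n i (i + (r + 2)) := by
      have := lowering_mem_bidegree ha
      rwa [show i + 1 + r + 1 = i + (r + 2) by ring] at this
    have h0 : (ambientL n ^ (r + 2)) (lowering n a) = 0 := by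
      have h' := ambientL_pow_succ_lowering
        (bidegree_le_ambientPiece (k := -(r : ℤ)) rfl (by push_cast; ring) ha)
      rw [pow_succ' _ r, Module.End.mul_apply _ _ a, h, map_zero, map_zero, ← pow_succ'] at h'
      rw [pow_succ', Module.End.mul_apply, h', map_zero]
    have := ambientL_pow_of_lowering_eq_zero ha (ih hF h0)
    rw [h] at this
    simpa [Nat.factorial_ne_zero] using this.symm

/-- Since `L^(r+1)` commutes with `F` on weight `-r`, it kills `F a`; hence so does `L^(r+2)`, which
is injective in the weight `-(r + 2)` of `F a`. -/
theorem lowering_eq_zero_of_primitive {n i r : ℕ} {a : D n ⊗[ℝ] R n}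
    (ha : a ∈ bidegree n i (i + r)) (h : (ambientL n ^ (r + 1)) a = 0) : lowering n a = 0 := by
  cases i with
  | zero => exact lowering_eq_zero ha
  | succ i =>
    have hF : lowering n a ∈ bidegree n i (i + (r + 2)) := by
      have := lowering_mem_bidegree ha
      rwa [show i + 1 + r + 1 = i + (r + 2) by ring] at this
    refine eq_zero_of_ambientL_pow_eq_zero i hF ?_
    rw [pow_succ', Module.End.mul_apply, ambientL_pow_succ_lowering
      (bidegree_le_ambientPiece (k := -(r : ℤ)) rfl (by push_cast; ring) ha), h, map_zero, map_zero]

/-- The sign `(-1)^i` cancels the one in the swap formula, leaving `r!` times the positive form. -/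
theorem hodge_riemann_of_bidegree {n i r : ℕ} {a : D n ⊗[ℝ] R n}
    (ha : a ∈ bidegree n i (i + r)) (h : (ambientL n ^ (r + 1)) a = 0) (h0 : a ≠ 0) :
    0 < (-1) ^ i * ambientPairing n a ((ambientL n ^ r) a) := by
  rw [ambientL_pow_of_lowering_eq_zero ha (lowering_eq_zero_of_primitive ha h), map_smul,
    smul_eq_mul, ← mul_assoc, ← mul_assoc, ← pow_add, Even.neg_one_pow ⟨i, rfl⟩, one_mul]
  exact mul_pos (by positivity) (ambientPairing_swap_pos h0)

/-! ### Properties of the pairing and of the symmetric group action -/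

theorem ambientPairing_comm {n : ℕ} (a b : D n ⊗[ℝ] R n) :
    ambientPairing n a b = ambientPairing n b a := by
  induction a with
  | zero => simp
  | tmul d f =>
    induction b with
    | zero => simp
    | tmul d' f' => rw [ambientPairing_tmul, ambientPairing_tmul, mul_comm]
    | add x y hx hy => simp only [map_add, LinearMap.add_apply, hx, hy]
  | add x y hx hy => simp only [map_add, LinearMap.add_apply, hx, hy]

theorem ambientRep_tmul {n : ℕ} (σ : Equiv.Perm (Fin n)) (d : D n) (f : R n) :
    ambientRep n σ (d ⊗ₜ f) = (rename σ d) ⊗ₜ[ℝ] (rename σ f) := rfl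

theorem ambientPairing_ambientRep {n : ℕ} (σ : Equiv.Perm (Fin n)) (a b : D n ⊗[ℝ] R n) :
    ambientPairing n (ambientRep n σ a) (ambientRep n σ b) = ambientPairing n a b := by
  induction a with
  | zero => simp
  | tmul d f =>
    induction b with
    | zero => simp
    | tmul d' f' =>
      have := fun d f => evalPairing_permRep σ d f
      rw [ambientRep_tmul, ambientRep_tmul, ambientPairing_tmul, ambientPairing_tmul,
        ← this d f', ← this d' f]
      rfl
    | add x y hx hy => simp only [map_add, hx, hy]
  | add x y hx hy => simp only [map_add, LinearMap.add_apply, hx, hy]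

theorem ambientL_ambientRep {n : ℕ} (σ : Equiv.Perm (Fin n)) (a : D n ⊗[ℝ] R n) :
    ambientL n (ambientRep n σ a) = ambientRep n σ (ambientL n a) := by
  induction a with
  | zero => simp
  | tmul d f =>
    rw [ambientRep_tmul, ambientL_tmul, ambientL_tmul, map_sum, ← Equiv.sum_comp σ]
    exact sum_congr rfl fun i _ => by
      rw [ambientRep_tmul, pderiv_rename σ.injective, map_mul, rename_X]
  | add x y hx hy => simp only [map_add, hx, hy]

theorem ambientL_self_adjoint {n : ℕ} (a b : D n ⊗[ℝ] R n) :
    ambientPairing n (ambientL n a) b = ambientPairing n a (ambientL n b) := by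
  induction a with
  | zero => simp
  | tmul d f =>
    induction b with
    | zero => simp
    | tmul d' f' =>
      rw [ambientL_tmul, ambientL_tmul, map_sum, map_sum, LinearMap.sum_apply]
      exact sum_congr rfl fun i _ => by
        rw [ambientPairing_tmul, ambientPairing_tmul, evalPairing_X_mul, evalPairing_X_mul]
    | add x y hx hy => simp only [map_add, hx, hy]
  | add x y hx hy => simp only [map_add, LinearMap.add_apply, hx, hy]

theorem ambientPairing_eq_zero_of_bidegree {n i j i' j' : ℕ} {a b : D n ⊗[ℝ] R n}
    (ha : a ∈ bidegree n i j) (hb : b ∈ bidegree n i' j') (h : i ≠ j') :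
    ambientPairing n a b = 0 := by
  have h₁ : bidegree n i j ≤ LinearMap.ker ((ambientPairing n).flip b) :=
    bidegree_le fun d f hd hf => by
      have h₂ : bidegree n i' j' ≤ LinearMap.ker (ambientPairing n (d ⊗ₜ f)) :=
        bidegree_le fun d' f' hd' hf' => by
          rw [LinearMap.mem_ker, ambientPairing_tmul, evalPairing_eq_zero hd hf' h, zero_mul]
      exact h₂ hb
  exact h₁ ha

theorem ambientPairing_eq_zero_of_ambientPiece {n m : ℕ} {k l : ℤ} {a b : D n ⊗[ℝ] R n}
    (ha : a ∈ ambientPiece n m k) (hb : b ∈ ambientPiece n m l) (h : k ≠ -l) :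
    ambientPairing n a b = 0 := by
  have h₁ : ambientPiece n m k ≤ LinearMap.ker ((ambientPairing n).flip b) :=
    ambientPiece_le fun i j hm hk a ha => by
      have h₂ : ambientPiece n m l ≤ LinearMap.ker (ambientPairing n a) :=
        ambientPiece_le fun i' j' hm' hl b hb => by
          -- With both total degrees equal to `m`, one has `k = 2 i - m` and `-l = 2 j' - m`, so `k
          -- ≠ -l` means `i ≠ j'`.
          exact ambientPairing_eq_zero_of_bidegree ha hb (by omega)
      exact h₂ hb
  exact h₁ ha

theorem ambientRep_mem_ambientPiece {n m : ℕ} {k : ℤ} {a : D n ⊗[ℝ] R n}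
    (σ : Equiv.Perm (Fin n)) (ha : a ∈ ambientPiece n m k) :
    ambientRep n σ a ∈ ambientPiece n m k := by
  have h : ambientPiece n m k ≤ (ambientPiece n m k).comap (ambientRep n σ) :=
    ambientPiece_le fun i j hm hk => bidegree_le fun d f hd hf =>
      bidegree_le_ambientPiece hm hk
        (tmul_mem_bidegree hd.rename_isHomogeneous hf.rename_isHomogeneous)
  exact h ha

/-! ### The graded space `H_{n,m}` -/

instance finiteDimensional_bidegree (n i j : ℕ) : FiniteDimensional ℝ (bidegree n i j) := by
  have h : ∀ k, FiniteDimensional ℝ (homogeneousSubmodule (Fin n) ℝ k) := fun k =>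
    Module.Finite.iff_fg.mpr (homogeneousSubmodule_fg (Fin n) ℝ k)
  have := h i
  have := h j
  unfold bidegree
  infer_instance

instance finiteDimensional_H (n m : ℕ) : FiniteDimensional ℝ (H n m) := by
  unfold H carrier
  infer_instance

theorem bidegree_le_carrier {n m i j : ℕ} (hm : i + j = m) : bidegree n i j ≤ carrier n m := by
  obtain rfl : j = m - i := by omega
  exact le_iSup (fun i : Fin (m + 1) => bidegree n i (m - i)) ⟨i, by omega⟩

theorem carrier_le {n m : ℕ} {S : Submodule ℝ (D n ⊗[ℝ] R n)}
    (h : ∀ i j : ℕ, i + j = m → bidegree n i j ≤ S) : carrier n m ≤ S :=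
  iSup_le fun i => h i (m - i) (by omega)

theorem swap_mem_carrier {n m : ℕ} {a : D n ⊗[ℝ] R n} (ha : a ∈ carrier n m) :
    swap n a ∈ carrier n m := by
  have h : carrier n m ≤ (carrier n m).comap (swap n).toLinearMap :=
    carrier_le fun i j hm a ha =>
      bidegree_le_carrier (by omega : j + i = m) (swap_mem_bidegree ha)
  exact h ha

theorem mem_piece {n m : ℕ} {k : ℤ} {a : H n m} :
    a ∈ piece n m k ↔ (a : D n ⊗[ℝ] R n) ∈ ambientPiece n m k := Iff.rfl

theorem coe_L_pow {n m : ℕ} (r : ℕ) (a : H n m) :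
    (((L n m) ^ r) a : D n ⊗[ℝ] R n) = (ambientL n ^ r) a := by
  induction r with
  | zero => simp
  | succ r ih => rw [pow_succ', pow_succ', Module.End.mul_apply, Module.End.mul_apply, ← ih]; rfl

theorem pairing_apply {n m : ℕ} (a b : H n m) :
    pairing n m a b = ambientPairing n a b := rfl

theorem L_rep {n m : ℕ} (σ : Equiv.Perm (Fin n)) (a : H n m) :
    L n m (rep n m σ a) = rep n m σ (L n m a) :=
  Subtype.ext (ambientL_ambientRep σ a)

theorem L_pow_rep {n m : ℕ} (σ : Equiv.Perm (Fin n)) (r : ℕ) (a : H n m) :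
    (L n m ^ r) (rep n m σ a) = rep n m σ ((L n m ^ r) a) := by
  induction r with
  | zero => rfl
  | succ r ih => rw [pow_succ', Module.End.mul_apply, ih, L_rep, Module.End.mul_apply]

theorem commutator_mem_carrier {n m : ℕ} :
    ∀ a ∈ carrier n m, (ambientL n * lowering n - lowering n * ambientL n) a ∈ carrier n m := by
  have h : carrier n m ≤
      (carrier n m).comap (ambientL n * lowering n - lowering n * ambientL n) :=
    carrier_le fun i j hm a ha => by
      rw [Submodule.mem_comap, commutator_apply_of_mem ha]
      exact Submodule.smul_mem _ _ (bidegree_le_carrier hm ha)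
  exact fun a ha => h ha

/-- The operator on `H_{n,m}` that multiplies the piece of degree `k` by `k`. -/
def weightOp (n m : ℕ) : Module.End ℝ (H n m) :=
  (ambientL n * lowering n - lowering n * ambientL n).restrict commutator_mem_carrier

/-- Eigenspaces for distinct eigenvalues are independent, so only spanning has to be assumed. -/
theorem isInternal_of_forall_apply_eq_smul {V : Type*} [AddCommMonoid V] [Module ℝ V]
    (W : Module.End ℝ V) (p : ℤ → Submodule ℝ V) (h : ∀ k, ∀ a ∈ p k, W a = (k : ℝ) • a)
    (htop : iSup p = ⊤) : DirectSum.IsInternal p := by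
  let := Module.addCommMonoidToAddCommGroup ℝ (M := V)
  exact DirectSum.isInternal_submodule_of_iSupIndep_of_iSup_eq_top
    ((W.eigenspaces_iSupIndep.comp (Int.cast_injective (α := ℝ))).mono fun k a ha =>
      Module.End.mem_eigenspace_iff.mpr (h k a ha)) htop

theorem isInternal_piece (n m : ℕ) : DirectSum.IsInternal (piece n m) := by
  refine isInternal_of_forall_apply_eq_smul (weightOp n m) _ (fun k a ha =>
    Subtype.ext (commutator_apply_of_mem_ambientPiece (mem_piece.mp ha))) ?_
  apply Submodule.map_injective_of_injective (carrier n m).injective_subtype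
  rw [Submodule.map_iSup, Submodule.map_top, Submodule.range_subtype]
  refine le_antisymm (iSup_le fun k => Submodule.map_subtype_le _ _)
    (carrier_le fun i j hm a ha => ?_)
  exact Submodule.mem_iSup_of_mem ((i : ℤ) - j)
    ⟨⟨a, bidegree_le_carrier hm ha⟩, bidegree_le_ambientPiece hm rfl ha, rfl⟩

theorem pairing_nondegenerate (n m : ℕ) : (pairing n m).Nondegenerate := by
  have key : ∀ a : H n m, a ≠ 0 → pairing n m a ⟨_, swap_mem_carrier a.2⟩ ≠ 0 := fun a ha =>
    (ambientPairing_swap_pos (fun h => ha (Subtype.ext h))).ne'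
  refine ⟨fun a h => ?_, fun a h => ?_⟩
  · by_contra ha
    exact key a ha (h _)
  · by_contra ha
    refine key a ha ?_
    rw [pairing_apply, ambientPairing_comm]
    exact h ⟨_, swap_mem_carrier a.2⟩

/-! ### Hard Lefschetz and Hodge–Riemann on `H_{n,m}`. -/

/-- Weights `±r` occur only if `m - r` is even and nonnegative; otherwise Hard Lefschetz compares
two zero spaces. -/
theorem ambientPiece_neg_eq_bot_or (n m r : ℕ) :
    (ambientPiece n m (-(r : ℤ)) = ⊥ ∧ ambientPiece n m r = ⊥) ∨
      ∃ i, m = i + (i + r) := by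
  by_cases h : ∃ i, m = i + (i + r)
  · exact Or.inr h
  · refine Or.inl ⟨?_, ?_⟩
    · exact le_bot_iff.mp (ambientPiece_le fun i j hm hk => absurd ⟨i, by omega⟩ h)
    · exact le_bot_iff.mp (ambientPiece_le fun i j hm hk => absurd ⟨j, by omega⟩ h)

/-- The swap carries the target of `L^r` back to its source, so the composite is an injective
endomorphism of a finite-dimensional space. -/
theorem ambientL_pow_surjOn {n i r : ℕ} {b : D n ⊗[ℝ] R n} (hb : b ∈ bidegree n (i + r) i) :
    ∃ a ∈ bidegree n i (i + r), (ambientL n ^ r) a = b := by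
  have hmem : ∀ a ∈ bidegree n i (i + r), (ambientL n ^ r) a ∈ bidegree n (i + r) i :=
    fun a ha => by
      have h := ambientL_pow_mem_ambientPiece
        (bidegree_le_ambientPiece (k := -(r : ℤ)) rfl (by push_cast; ring) ha) r
      rwa [ambientPiece_eq (add_comm (i + r) i) (by push_cast; ring)] at h
  let T : Module.End ℝ (bidegree n i (i + r)) :=
    ((swap n).toLinearMap ∘ₗ (ambientL n ^ r)).restrict
      fun a ha => swap_mem_bidegree (hmem a ha)
  have hT : Function.Injective T := by
    rw [injective_iff_map_eq_zero]
    intro a ha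
    have h : swap n ((ambientL n ^ r) a) = 0 := congrArg Subtype.val ha
    exact Subtype.ext (eq_zero_of_ambientL_pow_eq_zero i a.2 ((swap n).map_eq_zero_iff.mp h))
  obtain ⟨a, ha⟩ := LinearMap.injective_iff_surjective (V := bidegree n i (i + r)).mp hT
    ⟨swap n b, swap_mem_bidegree hb⟩
  exact ⟨a, a.2, (swap n).injective (congrArg Subtype.val ha)⟩

theorem hardLefschetz_piece (n m : ℕ) : HardLefschetz (piece n m) (L n m) := by
  intro r
  refine ⟨fun a ha => ?_, ?_, fun b hb => ?_⟩
  · have := ambientL_pow_mem_ambientPiece (mem_piece.mp ha) r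
    rw [show -(r : ℤ) + 2 * r = r by ring] at this
    rw [SetLike.mem_coe, mem_piece, coe_L_pow]
    exact this
  · intro a ha b hb hab
    have hd : (a - b : D n ⊗[ℝ] R n) ∈ ambientPiece n m (-(r : ℤ)) :=
      Submodule.sub_mem (M := D n ⊗[ℝ] R n) _ (mem_piece.mp ha) (mem_piece.mp hb)
    refine Subtype.ext (sub_eq_zero.mp ?_)
    rcases ambientPiece_neg_eq_bot_or n m r with ⟨h, -⟩ | ⟨i, rfl⟩
    · rw [h] at hd
      exact (Submodule.mem_bot ℝ).mp hd
    · rw [ambientPiece_eq rfl (by push_cast; ring)] at hd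
      refine eq_zero_of_ambientL_pow_eq_zero i hd ?_
      rw [map_sub, ← coe_L_pow, ← coe_L_pow, hab, sub_self]
  · have hb' := mem_piece.mp hb
    rcases ambientPiece_neg_eq_bot_or n m r with ⟨-, h⟩ | ⟨i, rfl⟩
    · rw [h] at hb'
      exact ⟨0, Submodule.zero_mem _,
        by rw [map_zero]; exact (Subtype.ext ((Submodule.mem_bot ℝ).mp hb')).symm⟩
    · rw [ambientPiece_eq (add_comm (i + r) i) (by push_cast; ring)] at hb'
      obtain ⟨a, ha, hab⟩ := ambientL_pow_surjOn hb'
      exact ⟨⟨a, bidegree_le_carrier rfl ha⟩,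
        bidegree_le_ambientPiece rfl (by push_cast; ring) ha, Subtype.ext (by rw [coe_L_pow, hab])⟩

theorem hodge_riemann_piece {n m i : ℕ} (hi : 2 * i ≤ m) {a : H n m}
    (ha : a ∈ primitive (piece n m) (L n m) (m - 2 * i)) (h0 : a ≠ 0) :
    0 < (-1 : ℝ) ^ i * lefschetzForm (pairing n m) (L n m) (m - 2 * i) a a := by
  obtain ⟨r, rfl⟩ : ∃ r, m = i + (i + r) := ⟨m - 2 * i, by omega⟩
  rw [show i + (i + r) - 2 * i = r by omega] at ha ⊢
  obtain ⟨hker, hp⟩ := Submodule.mem_inf.mp ha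
  rw [mem_piece, ambientPiece_eq rfl (by push_cast; ring)] at hp
  rw [lefschetzForm, LinearMap.compl₂_apply, pairing_apply, coe_L_pow]
  refine hodge_riemann_of_bidegree hp ?_ fun h => h0 (Subtype.ext h)
  rw [← coe_L_pow, LinearMap.mem_ker.mp hker]
  rfl

end

end HomCohom

theorem theorem4p1 (n m : ℕ) :
    -- `H_{n,m}` is a finite-dimensional graded representation of `S_n`
    (FiniteDimensional ℝ (H n m) ∧
      DirectSum.IsInternal (piece n m) ∧
      (∀ (σ : Equiv.Perm (Fin n)) (k : ℤ), ∀ a ∈ piece n m k, rep n m σ a ∈ piece n m k)) ∧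
    -- (a) Poincaré duality
    ((∀ (σ : Equiv.Perm (Fin n)) (a b : H n m),
        pairing n m (rep n m σ a) (rep n m σ b) = pairing n m a b) ∧
      (∀ a b : H n m, pairing n m a b = pairing n m b a) ∧
      IsGradedForm (piece n m) (pairing n m) ∧
      (pairing n m).Nondegenerate) ∧
    -- (b) hard Lefschetz
    ((∀ (σ : Equiv.Perm (Fin n)) (a : H n m), L n m (rep n m σ a) = rep n m σ (L n m a)) ∧
      IsLefschetzOperator (piece n m) (pairing n m) (L n m) ∧
      HardLefschetz (piece n m) (L n m)) ∧
    -- (c) Hodge–Riemann relations in degree `-m + 2 i = -(m - 2 i)`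
    (∀ i : ℕ, 2 * i ≤ m →
      (∀ σ : Equiv.Perm (Fin n),
        ∀ a ∈ piece n m (-(m : ℤ) + 2 * i), ∀ b ∈ piece n m (-(m : ℤ) + 2 * i),
          lefschetzForm (pairing n m) (L n m) (m - 2 * i) (rep n m σ a) (rep n m σ b) =
            lefschetzForm (pairing n m) (L n m) (m - 2 * i) a b) ∧
      (∀ a : H n m, a ∈ primitive (piece n m) (L n m) (m - 2 * i) → a ≠ 0 →
        0 < (-1 : ℝ) ^ i * lefschetzForm (pairing n m) (L n m) (m - 2 * i) a a)) := by
  refine ⟨⟨inferInstance, isInternal_piece n m, fun σ k a ha =>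
      ambientRep_mem_ambientPiece σ ha⟩,
    ⟨fun σ a b => ambientPairing_ambientRep σ a b, fun a b => ambientPairing_comm _ _,
      fun i j hij a ha b hb => ambientPairing_eq_zero_of_ambientPiece ha hb hij,
      pairing_nondegenerate n m⟩,
    ⟨L_rep, ⟨fun i a ha => ambientL_mem_ambientPiece ha,
      fun a b => ambientL_self_adjoint _ _⟩, hardLefschetz_piece n m⟩,
    fun i hi => ⟨fun σ a _ b _ => ?_, fun a ha h0 => hodge_riemann_piece hi ha h0⟩⟩
  rw [lefschetzForm, LinearMap.compl₂_apply, LinearMap.compl₂_apply, L_pow_rep]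
  exact ambientPairing_ambientRep σ _ _
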